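/- Let $d \ge 1$ be an integer, $\tau \in (2,3)$ and $\lambda > 0$. For a real number $n > 0$ let $G_n$ be the threshold geometric inhomogeneous random graph (GIRG) on $[0,1]^d$, defined as follows. The vertices are the points of a homogeneous Poisson point process on $[0,1]^d$ with $n$ expected points; independently, each vertex $v$ gets a weight $w_v > 1$ with the Pareto distribution $\Pr[w_v \le w] = 1 - w^{-(\tau-1)}$ for $w \ge 1$; and two distinct vertices $u, v$ are adjacent if and only if $\|x_u - x_v\|_\infty \le (\lambda w_u w_v / n)^{1/d}$, where $x_u, x_v \in [0,1]^d$ are their positions. Then $G_n$ has a connected component of size $\Theta(n)$ with probability $1 - \exp(-\Omega(n^{(3-\tau)/2}))$. That is, there are constants $c, C, a, n_0 > 0$, depending only on $d$, $\tau$ and $\lambda$, such that for every real $n \ge n_0$, $$\Pr\bigl[G_n \text{ has a connected component with at least } cn \text{ and at most } Cn \text{ vertices}\bigr] \ge 1 - \exp\bigl(-a\, n^{(3-\tau)/2}\bigr).$$ -/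

import Mathlib

open MeasureTheory ProbabilityTheory
open scoped NNReal

noncomputable section

namespace GIRG

/-- The ground space `[0,1]^d`. Its distance is the `L_∞` metric and its `volume` is the uniform
(Lebesgue) probability measure. -/
abbrev Box (d : ℕ) : Type := Fin d → unitInterval

/-- A vertex of the random graph as a marked point: its position and its weight. -/
abbrev MarkedPoint (d : ℕ) : Type := Box d × ℝ

/-- The law of one marked point: uniform position, and independently a weight `w > 1` with the
Pareto law `ℙ(w ≤ x) = 1 - x ^ (-(τ - 1))`. -/
def markedPointLaw (d : ℕ) (τ : ℝ) : Measure (MarkedPoint d) :=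
  (volume : Measure (Box d)).prod (paretoMeasure 1 (τ - 1))

/-- A sample: a number `N` of points and a sequence of marked points, the first `N` of which are
the points of the process. -/
abbrev Sample (d : ℕ) : Type := ℕ × (ℕ → MarkedPoint d)

/-- The law of the homogeneous Poisson point process on `[0,1]^d` with `n` expected points and
independent Pareto marks: the number of points is Poisson with mean `n`, and independently of it
the marked points are i.i.d. -/
def sampleLaw (d : ℕ) (n : ℝ≥0) (τ : ℝ) : Measure (Sample d) :=
  (poissonMeasure n).prod (Measure.infinitePi fun _ : ℕ => markedPointLaw d τ)

/-- The threshold GIRG on a sample: the vertices are the `N` points of the process, and two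
distinct vertices `u`, `v` are adjacent iff `dist (u, v) ≤ (lam * w_u * w_v / n) ^ (1 / d)`. -/
def thresholdGraph {d : ℕ} (n : ℝ≥0) (lam : ℝ) (ω : Sample d) : SimpleGraph (Fin ω.1) where
  Adj u v := u ≠ v ∧
    dist (ω.2 u).1 (ω.2 v).1 ≤ (lam * (ω.2 u).2 * (ω.2 v).2 / (n : ℝ)) ^ (1 / (d : ℝ))
  symm := ⟨fun u v h => ⟨h.1.symm, by
    rw [dist_comm, mul_assoc, mul_comm (ω.2 v).2, ← mul_assoc]; exact h.2⟩⟩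
  loopless := ⟨fun _ h => h.1 rfl⟩

/-- The event that the threshold GIRG has a connected component whose number of vertices lies
between `c * n` and `C * n`. -/
def linearComponentEvent (d : ℕ) (n : ℝ≥0) (lam c C : ℝ) : Set (Sample d) :=
  {ω | ∃ K : (thresholdGraph n lam ω).ConnectedComponent,
    c * (n : ℝ) ≤ (K.supp.ncard : ℝ) ∧ (K.supp.ncard : ℝ) ≤ C * (n : ℝ)}

theorem isProbabilityMeasure_markedPointLaw (d : ℕ) {τ : ℝ} (hτ : 1 < τ) :
    IsProbabilityMeasure (markedPointLaw d τ) := by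
  have := isProbabilityMeasure_paretoMeasure one_pos (sub_pos.2 hτ)
  unfold markedPointLaw
  infer_instance

/-- For `τ > 1` the law of the sample is a probability measure. -/
theorem isProbabilityMeasure_sampleLaw (d : ℕ) (n : ℝ≥0) {τ : ℝ} (hτ : 1 < τ) :
    IsProbabilityMeasure (sampleLaw d n τ) := by
  have := isProbabilityMeasure_markedPointLaw d hτ
  unfold sampleLaw
  infer_instance

end GIRG

end

/-! Split the cube into dyadic cells of side `2 ^ (-j)` and call a level-`j` cell void if it holds
no vertex of weight at least `W j`, where `lam * W (j + 1) ^ 2 = n / 2 ^ (d * j)`. Distinct vertices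
of weight at least `W (j + 1)` in one level-`j` cell are then adjacent, so heavy vertices of a cell
attach to those of its parent (`reachable_of_cellIndex_eq`). Stop at the level `J` where a cell has
a bounded expected number of points, so that there are `Θ(n)` leaves. Leaves that are not void and
have no void ancestor all contribute to the component of one heavy vertex
(`exists_card_le_ncard_supp`).

A level-`j` cell has on average `μ j = κ * (n / 2 ^ (d * j)) ^ ((3 - τ) / 2)` heavy vertices, and
distinct cells of a level are void independently with probability `exp (-μ j)`. A Chernoff bound
keeps the void fraction of level `j` below `ε j` (`sampleLaw_real_le_voidCount`). Since the `ε j`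
sum to at most `1 / 2`, half of the leaves survive. The failure bounds decay rapidly with the level,
so the root level dictates the exponent `n ^ ((3 - τ) / 2)`. The upper bound on the component is the
Poisson tail of the number of vertices. -/

namespace GIRG

/-! ### Concentration, Poisson void probabilities and the Pareto tail -/

/-- Chernoff bound for a sum of indicators whose joint probabilities are at most those of
independent events of probability `p`. -/
theorem measureReal_le_card_filter_le_exp {Ω ι : Type*} [MeasurableSpace Ω] (P : Measure Ω)
    [IsProbabilityMeasure P] (s : Finset ι) (B : ι → Set Ω) (hB : ∀ i, MeasurableSet (B i))
    [∀ ω, DecidablePred fun i => ω ∈ B i]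
    {p t x : ℝ} (ht : 0 ≤ t) (hp : 0 ≤ p)
    (h : ∀ S ⊆ s, P.real (⋂ i ∈ S, B i) ≤ p ^ S.card) :
    P.real {ω | x ≤ ((s.filter fun i => ω ∈ B i).card : ℝ)} ≤
      Real.exp (s.card * (p * Real.exp t) - t * x) := by
  classical
  have he : 0 ≤ Real.exp t - 1 := by linarith [Real.add_one_le_exp t]
  have hB' : ∀ S : Finset ι, MeasurableSet (⋂ i ∈ S, B i) := fun S =>
    S.measurableSet_biInter fun i _ => hB i
  -- Expansion of `exp (t * count) = ∏ (1 + (exp t - 1) * 1_{B i})` over subsets. Its coefficients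
  -- are nonnegative, so upper bounds on the intersections suffice.
  set f : Ω → ℝ := fun ω => ∑ S ∈ s.powerset,
    (Real.exp t - 1) ^ S.card * (⋂ i ∈ S, B i).indicator 1 ω with hf
  have hexp : ∀ ω, f ω = Real.exp (t * ((s.filter fun i => ω ∈ B i).card : ℝ)) := by
    intro ω
    have h1 : Real.exp (t * ((s.filter fun i => ω ∈ B i).card : ℝ)) =
        ∏ i ∈ s, (1 + if ω ∈ B i then (Real.exp t - 1) else 0) := by
      rw [mul_comm, Real.exp_nat_mul, ← Finset.prod_const, Finset.prod_filter]
      refine Finset.prod_congr rfl fun i _ => ?_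
      split_ifs <;> ring
    rw [h1, Finset.prod_one_add]
    refine Finset.sum_congr rfl fun S _ => ?_
    by_cases hS : ω ∈ ⋂ i ∈ S, B i
    · rw [Set.indicator_of_mem hS, Pi.one_apply, mul_one, ← Finset.prod_const]
      refine Finset.prod_congr rfl fun i hi => ?_
      rw [if_pos (Set.mem_iInter₂.1 hS i hi)]
    · rw [Set.indicator_of_notMem hS, mul_zero]
      simp only [Set.mem_iInter, not_forall] at hS
      obtain ⟨i, hi, hi'⟩ := hS
      rw [Finset.prod_eq_zero hi (if_neg hi')]
  have hint : ∀ S ∈ s.powerset, Integrable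
      (fun ω => (Real.exp t - 1) ^ S.card * (⋂ i ∈ S, B i).indicator 1 ω) P := fun S _ =>
    ((integrable_const (1 : ℝ)).indicator (hB' S)).const_mul _
  have hfint : Integrable f P := integrable_finsetSum _ hint
  have hle : ∫ ω, f ω ∂P ≤ Real.exp (s.card * (p * Real.exp t)) := by
    calc ∫ ω, f ω ∂P
        = ∑ S ∈ s.powerset, (Real.exp t - 1) ^ S.card * P.real (⋂ i ∈ S, B i) := by
          rw [hf, integral_finsetSum _ hint]
          refine Finset.sum_congr rfl fun S _ => ?_
          rw [integral_const_mul, integral_indicator_one (hB' S)]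
      _ ≤ ∑ S ∈ s.powerset, (Real.exp t - 1) ^ S.card * p ^ S.card := by
          refine Finset.sum_le_sum fun S hS => ?_
          exact mul_le_mul_of_nonneg_left (h S (Finset.mem_powerset.1 hS)) (pow_nonneg he _)
      _ = (1 + (Real.exp t - 1) * p) ^ s.card := by
          rw [← Finset.prod_const, Finset.prod_one_add]
          refine Finset.sum_congr rfl fun S _ => ?_
          rw [Finset.prod_const, mul_pow]
      _ ≤ Real.exp (s.card * (p * Real.exp t)) := by
          rw [Real.exp_nat_mul]
          refine pow_le_pow_left₀ (by positivity) ?_ _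
          linarith [Real.add_one_le_exp (p * Real.exp t)]
  have hset : {ω | x ≤ ((s.filter fun i => ω ∈ B i).card : ℝ)} ⊆
      {ω | Real.exp (t * x) ≤ f ω} := by
    intro ω hω
    simp only [Set.mem_ofPred_eq] at hω ⊢
    rw [hexp]
    exact Real.exp_le_exp.2 (mul_le_mul_of_nonneg_left hω ht)
  have hm := mul_meas_ge_le_integral_of_nonneg (μ := P) (f := f)
    (Filter.Eventually.of_forall fun ω => by
      simp only [Pi.zero_apply, hexp]; positivity) hfint (Real.exp (t * x))
  rw [Real.exp_sub, le_div_iff₀ (Real.exp_pos _), mul_comm]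
  exact (mul_le_mul_of_nonneg_left (measureReal_mono hset) (Real.exp_pos _).le).trans
    (hm.trans hle)

theorem lintegral_pow_poissonMeasure (n : ℝ≥0) {z : ℝ} (hz : 0 ≤ z) :
    ∫⁻ k, ENNReal.ofReal z ^ k ∂(poissonMeasure n) = ENNReal.ofReal (Real.exp (n * (z - 1))) := by
  have hs : HasSum (fun k : ℕ => Real.exp (-n) * (n : ℝ) ^ k / k.factorial * z ^ k)
      (Real.exp (n * (z - 1))) := by
    have h := (NormedSpace.expSeries_div_hasSum_exp (n * z : ℝ)).mul_left (Real.exp (-n))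
    rw [← Real.exp_eq_exp_ℝ, ← Real.exp_add] at h
    rw [show (n : ℝ) * (z - 1) = -n + n * z by ring]
    have e : (fun k : ℕ => Real.exp (-n) * (n : ℝ) ^ k / k.factorial * z ^ k) =
        fun k : ℕ => Real.exp (-n) * ((n * z : ℝ) ^ k / k.factorial) :=
      funext fun k => by rw [mul_pow]; ring
    rw [e]; exact h
  rw [poissonMeasure, lintegral_sum_measure]
  simp only [lintegral_smul_measure, lintegral_dirac, smul_eq_mul]
  rw [← hs.tsum_eq, ENNReal.ofReal_tsum_of_nonneg (fun k => by positivity) hs.summable]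
  refine tsum_congr fun k => ?_
  rw [ENNReal.ofReal_mul (by positivity), ENNReal.ofReal_pow hz]

theorem measurableSet_forall_lt_notMem {α : Type*} [MeasurableSpace α] {A : Set α}
    (hA : MeasurableSet A) :
    MeasurableSet {ω : ℕ × (ℕ → α) | ∀ i < ω.1, ω.2 i ∉ A} := by
  simp only [Set.ofPred_forall]
  refine MeasurableSet.iInter fun i => ?_
  have h1 : MeasurableSet {ω : ℕ × (ℕ → α) | i < ω.1} :=
    measurable_fst (measurableSet_Ioi (a := i))
  have h2 : MeasurableSet {ω : ℕ × (ℕ → α) | ω.2 i ∉ A} :=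
    ((measurable_pi_apply (X := fun _ : ℕ => α) i).comp measurable_snd) hA.compl
  convert h1.compl.union h2 using 1
  ext ω
  simp [imp_iff_not_or]

/-- The void probabilities of the Poisson process with i.i.d. marked points. -/
theorem sampleLaw_real_void (d : ℕ) (n : ℝ≥0) {τ : ℝ} (hτ : 1 < τ) {A : Set (MarkedPoint d)}
    (hA : MeasurableSet A) :
    (sampleLaw d n τ).real {ω | ∀ i < ω.1, ω.2 i ∉ A} =
      Real.exp (-(n * (markedPointLaw d τ).real A)) := by
  have := isProbabilityMeasure_markedPointLaw d hτ
  rw [measureReal_def, sampleLaw, Measure.prod_apply (measurableSet_forall_lt_notMem hA)]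
  -- Given `k` points, all avoid `A` with probability `(1 - ℙ(A)) ^ k`; the Poisson generating
  -- function then averages over `k`.
  have h : ∀ k : ℕ, (Measure.infinitePi fun _ : ℕ => markedPointLaw d τ)
      (Prod.mk k ⁻¹' {ω : Sample d | ∀ i < ω.1, ω.2 i ∉ A}) =
      ENNReal.ofReal (1 - (markedPointLaw d τ).real A) ^ k := by
    intro k
    have : Prod.mk k ⁻¹' {ω : Sample d | ∀ i < ω.1, ω.2 i ∉ A} =
        Set.pi (Finset.range k : Finset ℕ) fun _ => Aᶜ := by
      ext f; simp [Set.mem_pi]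
    rw [this, Measure.infinitePi_pi _ fun _ _ => hA.compl, Finset.prod_const, Finset.card_range,
      ← probReal_compl_eq_one_sub hA, ofReal_measureReal]
  simp only [h]
  rw [lintegral_pow_poissonMeasure n (sub_nonneg.2 measureReal_le_one),
    ENNReal.toReal_ofReal (Real.exp_pos _).le]
  congr 1; ring

theorem sampleLaw_real_lt_fst_le_exp (d : ℕ) (n : ℝ≥0) {τ : ℝ} (hτ : 1 < τ) :
    (sampleLaw d n τ).real {ω | 4 * (n : ℝ) < ω.1} ≤ Real.exp (-n) := by
  have := isProbabilityMeasure_markedPointLaw d hτ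
  have hpre : (sampleLaw d n τ).real {ω | 4 * (n : ℝ) < ω.1} =
      (poissonMeasure n).real {k : ℕ | 4 * (n : ℝ) < k} := by
    have : {ω : Sample d | 4 * (n : ℝ) < ω.1} = {k : ℕ | 4 * (n : ℝ) < k} ×ˢ Set.univ := by
      ext; simp
    rw [this, sampleLaw, measureReal_prod_prod]
    simp
  rw [hpre, measureReal_def]
  refine ENNReal.toReal_le_of_le_ofReal (Real.exp_pos _).le ?_
  -- Markov's inequality for `2 ^ N`, of mean `exp n`, at level `exp (2 * n)`; this level is reached
  -- when `N > 4 * n` because `4 * log 2 > 2`.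
  have hm := mul_meas_ge_le_lintegral (μ := poissonMeasure n)
    (f := fun k : ℕ => ENNReal.ofReal 2 ^ k) (measurable_of_countable _)
    (ENNReal.ofReal (Real.exp (2 * n)))
  rw [lintegral_pow_poissonMeasure n (by norm_num)] at hm
  have hsub : {k : ℕ | 4 * (n : ℝ) < k} ⊆
      {k : ℕ | ENNReal.ofReal (Real.exp (2 * n)) ≤ ENNReal.ofReal 2 ^ k} := by
    intro k hk
    simp only [Set.mem_ofPred_eq] at hk ⊢
    rw [← ENNReal.ofReal_pow (by norm_num)]
    refine ENNReal.ofReal_le_ofReal ?_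
    rw [← Real.exp_log (show (0 : ℝ) < 2 ^ k by positivity), Real.log_pow]
    refine Real.exp_le_exp.2 ?_
    nlinarith [Real.log_two_gt_d9, n.coe_nonneg]
  have h2 := (mul_le_mul_right (measure_mono (μ := poissonMeasure n) hsub)
    (ENNReal.ofReal (Real.exp (2 * n)))).trans hm
  rw [mul_comm, ← ENNReal.le_div_iff_mul_le (by simp [Real.exp_pos]) (by simp),
    ← ENNReal.ofReal_div_of_pos (Real.exp_pos _), ← Real.exp_sub] at h2
  convert h2 using 3
  ring

theorem paretoMeasure_real_Ici {r w : ℝ} (hr : 0 < r) (hw : 1 ≤ w) :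
    (paretoMeasure 1 r).real (Set.Ici w) = w ^ (-r) := by
  have hw0 : 0 < w := by linarith
  rw [measureReal_def, paretoMeasure, withDensity_apply _ measurableSet_Ici]
  have h1 : ∫⁻ x in Set.Ici w, paretoPDF 1 r x =
      ∫⁻ x in Set.Ici w, ENNReal.ofReal (r * x ^ (-(r + 1))) := by
    refine setLIntegral_congr_fun measurableSet_Ici fun x hx => ?_
    simp [paretoPDF_of_le (hw.trans hx)]
  rw [h1, setLIntegral_congr Ioi_ae_eq_Ici.symm,
    ← ofReal_integral_eq_lintegral_ofReal, integral_const_mul,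
    integral_Ioi_rpow_of_lt (by linarith) hw0, ENNReal.toReal_ofReal]
  · rw [show -(r + 1) + 1 = -r by ring]; field_simp
  · rw [show -(r + 1) + 1 = -r by ring, neg_div_neg_eq]; positivity
  · exact (integrableOn_Ioi_rpow_of_lt (by linarith) hw0).const_mul r
  · refine (ae_restrict_iff' measurableSet_Ioi).2 (Filter.Eventually.of_forall fun x hx => ?_)
    have : 0 < x := hw0.trans hx
    simp only [Pi.zero_apply]; positivity

/-! ### Dyadic cells and their heavy vertices -/

noncomputable section

/-- The index of the half-open dyadic cell of side `2 ^ (-j)` that contains `x`. -/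
def cellIndex {d : ℕ} (j : ℕ) (x : Box d) : Fin d → ℕ := fun i => ⌊(2 : ℝ) ^ j * (x i : ℝ)⌋₊

/-- The indices of the dyadic cells of side `2 ^ (-j)`. -/
def cells (d j : ℕ) : Finset (Fin d → ℕ) := Fintype.piFinset fun _ => Finset.range (2 ^ j)

/-- The marked points in the cell `c` of level `j` with weight at least `W`. -/
def heavyRegion {d : ℕ} (j : ℕ) (W : ℝ) (c : Fin d → ℕ) : Set (MarkedPoint d) :=
  (cellIndex j ⁻¹' {c}) ×ˢ Set.Ici W

/-- The event that the process has no point in the given region. -/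
def voidEvent {d : ℕ} (A : Set (MarkedPoint d)) : Set (Sample d) := {ω | ∀ i < ω.1, ω.2 i ∉ A}

theorem mem_cells {d j : ℕ} {c : Fin d → ℕ} : c ∈ cells d j ↔ ∀ i, c i < 2 ^ j := by
  simp [cells]

theorem card_cells (d j : ℕ) : (cells d j).card = (2 ^ d) ^ j := by
  simp [cells, ← pow_mul, mul_comm]

theorem cellIndex_eq_div {d : ℕ} (j k : ℕ) (x : Box d) (i : Fin d) :
    cellIndex j x i = cellIndex (j + k) x i / 2 ^ k := by
  have h : (2 : ℝ) ^ j * (x i : ℝ) = (2 : ℝ) ^ (j + k) * (x i : ℝ) / ((2 ^ k : ℕ) : ℝ) := by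
    push_cast; rw [pow_add]; field_simp
  rw [cellIndex, h, Nat.floor_div_natCast]; rfl

theorem measurable_cellIndex {d : ℕ} (j : ℕ) : Measurable (cellIndex (d := d) j) := by
  refine measurable_pi_lambda _ fun i => Nat.measurable_floor.comp ?_
  exact (measurable_subtype_coe.comp (measurable_pi_apply i)).const_mul _

theorem volume_real_cellIndex_preimage {d j : ℕ} {c : Fin d → ℕ} (hc : c ∈ cells d j) :
    (volume : Measure (Box d)).real (cellIndex j ⁻¹' {c}) = ((2 ^ d : ℝ) ^ j)⁻¹ := by
  have hset : cellIndex (d := d) j ⁻¹' {c} =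
      Set.univ.pi fun i => {y : unitInterval | ⌊(2 : ℝ) ^ j * (y : ℝ)⌋₊ = c i} := by
    ext x; simp [cellIndex, funext_iff]
  have hvol : ∀ i, (volume : Measure unitInterval)
      {y : unitInterval | ⌊(2 : ℝ) ^ j * (y : ℝ)⌋₊ = c i} = ENNReal.ofReal ((2 ^ j : ℝ)⁻¹) := by
    intro i
    have hci : (c i : ℝ) + 1 ≤ 2 ^ j := by exact_mod_cast mem_cells.1 hc i
    have h2 : (0 : ℝ) < 2 ^ j := by positivity
    have himg : Subtype.val '' {y : unitInterval | ⌊(2 : ℝ) ^ j * (y : ℝ)⌋₊ = c i} =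
        Set.Ico ((c i : ℝ) / 2 ^ j) ((c i + 1 : ℝ) / 2 ^ j) := by
      ext y
      simp only [Set.mem_image, Set.mem_ofPred_eq, Subtype.exists, exists_and_right, exists_eq_right,
        Set.mem_Ico]
      constructor
      · rintro ⟨hy, h⟩
        rw [Nat.floor_eq_iff (mul_nonneg h2.le hy.1)] at h
        rw [div_le_iff₀' h2, lt_div_iff₀' h2]
        exact h
      · rintro ⟨ha, hb⟩
        have hy0 : 0 ≤ y := le_trans (by positivity) ha
        have hy1 : y ≤ 1 := hb.le.trans ((div_le_one h2).2 hci)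
        refine ⟨⟨hy0, hy1⟩, ?_⟩
        rw [Nat.floor_eq_iff (mul_nonneg h2.le hy0)]
        rw [div_le_iff₀' h2] at ha
        rw [lt_div_iff₀' h2] at hb
        exact ⟨ha, hb⟩
    rw [unitInterval.volume_apply, himg, Real.volume_Ico]
    congr 1; field_simp; ring
  rw [hset, measureReal_def, volume_pi, Measure.pi_pi]
  simp only [hvol, Finset.prod_const, Finset.card_univ, Fintype.card_fin]
  rw [ENNReal.toReal_pow, ENNReal.toReal_ofReal (by positivity), inv_pow, ← pow_mul, ← pow_mul,
    mul_comm]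

theorem measurableSet_heavyRegion {d : ℕ} (j : ℕ) (W : ℝ) (c : Fin d → ℕ) :
    MeasurableSet (heavyRegion j W c) :=
  (measurable_cellIndex j (measurableSet_singleton c)).prod measurableSet_Ici

theorem markedPointLaw_real_heavyRegion {d j : ℕ} {τ W : ℝ} (hτ : 1 < τ) (hW : 1 ≤ W)
    {c : Fin d → ℕ} (hc : c ∈ cells d j) :
    (markedPointLaw d τ).real (heavyRegion j W c) = ((2 ^ d : ℝ) ^ j)⁻¹ * W ^ (-(τ - 1)) := by
  have := isProbabilityMeasure_paretoMeasure one_pos (sub_pos.2 hτ)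
  rw [markedPointLaw, heavyRegion, measureReal_prod_prod, volume_real_cellIndex_preimage hc,
    paretoMeasure_real_Ici (sub_pos.2 hτ) hW]

/-- Joint voidness of disjoint regions is voidness of their union, whose measure is additive; the
exponential turns the sum into a product. -/
theorem sampleLaw_real_iInter_voidEvent_heavyRegion {d j : ℕ} (n : ℝ≥0) {τ W : ℝ} (hτ : 1 < τ)
    (hW : 1 ≤ W) {S : Finset (Fin d → ℕ)} (hS : S ⊆ cells d j) :
    (sampleLaw d n τ).real (⋂ c ∈ S, voidEvent (heavyRegion j W c)) =
      Real.exp (-(n * (((2 ^ d : ℝ) ^ j)⁻¹ * W ^ (-(τ - 1))))) ^ S.card := by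
  have := isProbabilityMeasure_markedPointLaw d hτ
  have hset : (⋂ c ∈ S, voidEvent (heavyRegion j W c)) =
      {ω : Sample d | ∀ i < ω.1, ω.2 i ∉ ⋃ c ∈ S, heavyRegion j W c} := by
    ext ω
    simp only [voidEvent, Set.mem_iInter, Set.mem_ofPred_eq, Set.mem_iUnion, not_exists]
    exact ⟨fun h i hi c hc => h c hc i hi, fun h c hc i hi => h i hi c hc⟩
  have hdisj : Set.PairwiseDisjoint (S : Set (Fin d → ℕ)) (heavyRegion (d := d) j W) := by
    intro a _ b _ hab
    refine Set.disjoint_left.2 fun x hx hy => hab ?_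
    exact (Set.mem_singleton_iff.1 hx.1).symm.trans hy.1
  rw [hset, sampleLaw_real_void d n hτ
      (S.measurableSet_biUnion fun c _ => measurableSet_heavyRegion j W c),
    measureReal_biUnion_finset hdisj fun c _ => measurableSet_heavyRegion j W c,
    Finset.sum_congr rfl fun c hc => markedPointLaw_real_heavyRegion hτ hW (hS hc),
    Finset.sum_const, nsmul_eq_mul, ← Real.exp_nat_mul]
  congr 1; ring

/-! ### Few void cells on a level -/

open scoped Classical in
/-- The number of cells of level `j` without a point of weight at least `W`. -/
def voidCount {d : ℕ} (j : ℕ) (W : ℝ) (ω : Sample d) : ℕ :=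
  ((cells d j).filter fun c => ω ∈ voidEvent (heavyRegion j W c)).card

theorem sampleLaw_real_le_voidCount {d j : ℕ} (n : ℝ≥0) {τ W μ ε : ℝ} (hτ : 1 < τ)
    (hW : 1 ≤ W) (hμ : μ = n * (((2 ^ d : ℝ) ^ j)⁻¹ * W ^ (-(τ - 1)))) (hμε : 4 ≤ μ * ε) :
    (sampleLaw d n τ).real {ω | ε * (2 ^ d : ℝ) ^ j ≤ voidCount j W ω} ≤
      Real.exp (-((2 ^ d : ℝ) ^ j * μ * ε / 4)) := by
  classical
  have := isProbabilityMeasure_sampleLaw d n hτ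
  have hμ0 : 0 ≤ μ := by rw [hμ]; positivity
  have h := measureReal_le_card_filter_le_exp (sampleLaw d n τ) (cells d j)
    (fun c => voidEvent (heavyRegion j W c))
    (fun c => measurableSet_forall_lt_notMem (measurableSet_heavyRegion j W c))
    -- With `t = μ / 2` the exponent per cell is `exp (-μ / 2) - μ * ε / 2 ≤ 1 - μ * ε / 2`, and `4
    -- ≤ μ * ε` absorbs the `1`.
    (p := Real.exp (-μ)) (t := μ / 2) (x := ε * (2 ^ d : ℝ) ^ j) (by positivity)
    (Real.exp_pos _).le
    (fun S hS => by rw [hμ, sampleLaw_real_iInter_voidEvent_heavyRegion n hτ hW hS])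
  refine le_trans (le_of_eq ?_) (h.trans (Real.exp_le_exp.2 ?_))
  · unfold voidCount; congr!
  rw [← Real.exp_add, card_cells]
  push_cast
  have h1 : Real.exp (-μ + μ / 2) ≤ 1 := Real.exp_le_one_iff.2 (by linarith)
  have h2 : (0 : ℝ) < (2 ^ d) ^ j := by positivity
  nlinarith

/-! ### From non-void cells to a large component -/

theorem reachable_of_cellIndex_eq {d : ℕ} (hd : 1 ≤ d) {n : ℝ≥0} (hn : 0 < n) {lam w : ℝ}
    (hlam : 0 < lam) (hw : 0 ≤ w) {j : ℕ} (hj : (n : ℝ) ≤ lam * w ^ 2 * (2 ^ d) ^ j)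
    {ω : Sample d} {u v : Fin ω.1}
    (huv : cellIndex j (ω.2 u).1 = cellIndex j (ω.2 v).1) (hu : w ≤ (ω.2 u).2)
    (hv : w ≤ (ω.2 v).2) : (thresholdGraph n lam ω).Reachable u v := by
  by_cases hne : u = v
  · rw [hne]
  refine SimpleGraph.Adj.reachable ⟨hne, ?_⟩
  have hn' : (0 : ℝ) < n := hn
  have h2 : (0 : ℝ) < 2 ^ j := by positivity
  have hdist : dist (ω.2 u).1 (ω.2 v).1 ≤ ((2 : ℝ) ^ j)⁻¹ := by
    refine (dist_pi_le_iff (by positivity)).2 fun i => ?_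
    have hi := congrFun huv i
    simp only [cellIndex] at hi
    rw [Subtype.dist_eq, Real.dist_eq, abs_le]
    have a1 := Nat.floor_le (mul_nonneg h2.le ((ω.2 u).1 i).2.1)
    have a2 := Nat.lt_floor_add_one ((2 : ℝ) ^ j * ((ω.2 u).1 i : ℝ))
    have b1 := Nat.floor_le (mul_nonneg h2.le ((ω.2 v).1 i).2.1)
    have b2 := Nat.lt_floor_add_one ((2 : ℝ) ^ j * ((ω.2 v).1 i : ℝ))
    rw [hi] at a1 a2
    have e : (2 : ℝ) ^ j * ((2 : ℝ) ^ j)⁻¹ = 1 := mul_inv_cancel₀ h2.ne'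
    constructor <;> refine le_of_mul_le_mul_left ?_ h2 <;> linarith
  refine hdist.trans ?_
  have hroot : ((2 : ℝ) ^ j)⁻¹ = (((2 ^ d : ℝ) ^ j)⁻¹) ^ (1 / (d : ℝ)) := by
    rw [← pow_mul, mul_comm, pow_mul, ← inv_pow ((2 : ℝ) ^ j), one_div,
      Real.pow_rpow_inv_natCast (by positivity) (Nat.one_le_iff_ne_zero.1 hd)]
  rw [hroot]
  refine Real.rpow_le_rpow (by positivity) ?_ (by positivity)
  have hww : w ^ 2 ≤ (ω.2 u).2 * (ω.2 v).2 := by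
    rw [sq]; exact mul_le_mul hu hv hw (hw.trans hu)
  rw [le_div_iff₀ hn', inv_mul_le_iff₀ (by positivity), mul_assoc lam, mul_comm ((2 ^ d : ℝ) ^ j)]
  refine hj.trans ?_
  gcongr

/-- Every leaf cell of level `J` all of whose ancestors contain a sufficiently heavy vertex
contributes a vertex to one and the same component. -/
theorem exists_card_le_ncard_supp {d : ℕ} (hd : 1 ≤ d) {n : ℝ≥0} (hn : 0 < n) {lam : ℝ}
    (hlam : 0 < lam) {W : ℕ → ℝ} (hW0 : ∀ j, 0 ≤ W j) (hWanti : Antitone W)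
    (hW : ∀ j, (n : ℝ) ≤ lam * W (j + 1) ^ 2 * (2 ^ d) ^ j) {J : ℕ} {ω : Sample d}
    {G : Finset (Fin d → ℕ)} (hGc : G ⊆ cells d J) (hGne : G.Nonempty)
    (hG : ∀ c ∈ G, ∀ j ≤ J, ω ∉ voidEvent (heavyRegion j (W j) fun i => c i / 2 ^ (J - j))) :
    ∃ K : (thresholdGraph n lam ω).ConnectedComponent, G.card ≤ K.supp.ncard := by
  classical
  have hex : ∀ c ∈ G, ∀ j ≤ J, ∃ u : Fin ω.1,
      cellIndex j (ω.2 u).1 = (fun i => c i / 2 ^ (J - j)) ∧ W j ≤ (ω.2 u).2 := by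
    intro c hc j hj
    have := hG c hc j hj
    simp only [voidEvent, Set.mem_ofPred_eq, not_forall, not_not] at this
    obtain ⟨i, hi, h⟩ := this
    exact ⟨⟨i, hi⟩, h.1, h.2⟩
  have hroot : ∀ c ∈ G, (fun i => c i / 2 ^ (J - 0)) = (0 : Fin d → ℕ) := fun c hc =>
    funext fun i => Nat.div_eq_of_lt (mem_cells.1 (hGc hc) i)
  obtain ⟨c₀, hc₀⟩ := hGne
  obtain ⟨r, hr, hrw⟩ := hex c₀ hc₀ 0 (Nat.zero_le _)
  rw [hroot c₀ hc₀] at hr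
  -- Induction down the tree: a heavy vertex of an ancestor cell is linked to a heavy vertex of the
  -- parent cell, both having weight at least `W (j + 1)`.
  have hreach : ∀ c ∈ G, ∀ j ≤ J, ∀ u : Fin ω.1,
      cellIndex j (ω.2 u).1 = (fun i => c i / 2 ^ (J - j)) → W j ≤ (ω.2 u).2 →
      (thresholdGraph n lam ω).Reachable u r := by
    intro c hc j
    induction j with
    | zero =>
      intro _ u hu huw
      rw [hroot c hc] at hu
      have h01 : W 1 ≤ W 0 := hWanti (Nat.zero_le _)
      exact reachable_of_cellIndex_eq hd hn hlam (hW0 1) (hW 0) (hu.trans hr.symm)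
        (h01.trans huw) (h01.trans hrw)
    | succ j ih =>
      intro hj u hu huw
      obtain ⟨u', hu', huw'⟩ := hex c hc j (by omega)
      have huj : cellIndex j (ω.2 u).1 = fun i => c i / 2 ^ (J - j) := by
        funext i
        rw [cellIndex_eq_div j 1, hu, Nat.div_div_eq_div_mul, ← pow_add]
        congr 2; omega
      exact (reachable_of_cellIndex_eq hd hn hlam (hW0 _) (hW j) (huj.trans hu'.symm) huw
        ((hWanti (Nat.le_succ j)).trans huw')).trans (ih (by omega) u' hu' huw')
  refine ⟨(thresholdGraph n lam ω).connectedComponentMk r, ?_⟩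
  -- Distinct leaves have distinct indices, so the component has at least as many vertices as `G`
  -- has leaves.
  have hsub : (G : Set (Fin d → ℕ)) ⊆ (fun u : Fin ω.1 => cellIndex J (ω.2 u).1) ''
      ((thresholdGraph n lam ω).connectedComponentMk r).supp := by
    intro c hc
    obtain ⟨u, hu, huw⟩ := hex c hc J le_rfl
    refine ⟨u, ?_, by simpa using hu⟩
    exact SimpleGraph.ConnectedComponent.eq.2 (hreach c hc J le_rfl u hu huw)
  rw [← Set.ncard_coe_finset]
  exact (Set.ncard_le_ncard hsub (Set.toFinite _)).trans (Set.ncard_image_le (Set.toFinite _))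

theorem card_filter_div_mem_le {d j J : ℕ} (B : Finset (Fin d → ℕ)) :
    ((cells d J).filter fun c => (fun i => c i / 2 ^ (J - j)) ∈ B).card ≤
      (2 ^ d) ^ (J - j) * B.card := by
  classical
  refine Finset.card_le_mul_card_image_of_maps_to
    (f := fun c : Fin d → ℕ => fun i => c i / 2 ^ (J - j)) (fun c hc => (Finset.mem_filter.1 hc).2)
    _ fun b _ => ?_
  calc _ ≤ (Fintype.piFinset fun i : Fin d =>
          Finset.Ico (2 ^ (J - j) * b i) (2 ^ (J - j) * b i + 2 ^ (J - j))).card := by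
        refine Finset.card_le_card fun c hc => Fintype.mem_piFinset.2 fun i => ?_
        have h := congrFun (Finset.mem_filter.1 hc).2 i
        have hlt := Nat.lt_mul_div_succ (c i) (show 0 < 2 ^ (J - j) by positivity)
        have hle := Nat.mul_div_le (c i) (2 ^ (J - j))
        rw [h] at hlt hle
        rw [Finset.mem_Ico]
        exact ⟨hle, by rw [mul_add, mul_one] at hlt; exact hlt⟩
    _ = (2 ^ d) ^ (J - j) := by simp [← pow_mul, mul_comm]

/-- If few cells on every level are void, then some component has linear size. -/
theorem exists_le_ncard_supp_of_voidCount_lt {d : ℕ} (hd : 1 ≤ d) {n : ℝ≥0} (hn : 0 < n) {lam : ℝ}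
    (hlam : 0 < lam) {W : ℕ → ℝ} (hW0 : ∀ j, 0 ≤ W j) (hWanti : Antitone W)
    (hW : ∀ j, (n : ℝ) ≤ lam * W (j + 1) ^ 2 * (2 ^ d) ^ j) {J : ℕ} {ω : Sample d} {ε : ℕ → ℝ}
    (hε : ∑ j ∈ Finset.range (J + 1), ε j ≤ 1 / 2)
    (h : ∀ j ∈ Finset.range (J + 1), (voidCount j (W j) ω : ℝ) < ε j * (2 ^ d : ℝ) ^ j) :
    ∃ K : (thresholdGraph n lam ω).ConnectedComponent,
      (2 ^ d : ℝ) ^ J / 2 ≤ (K.supp.ncard : ℝ) := by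
  classical
  set B : ℕ → Finset (Fin d → ℕ) := fun j =>
    (cells d j).filter fun c => ω ∈ voidEvent (heavyRegion j (W j) c) with hB
  have hBcard : ∀ j, (B j).card = voidCount j (W j) ω := fun j => by
    simp only [hB, voidCount]
  set F : ℕ → Finset (Fin d → ℕ) := fun j =>
    (cells d J).filter fun c => (fun i => c i / 2 ^ (J - j)) ∈ B j with hF
  set G := cells d J \ (Finset.range (J + 1)).biUnion F with hGdef
  -- A void cell of level `j` spoils at most its `(2 ^ d) ^ (J - j)` descendant leaves.
  have hFcard : ∀ j ∈ Finset.range (J + 1), ((F j).card : ℝ) ≤ ε j * (2 ^ d : ℝ) ^ J := by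
    intro j hj
    have hjJ : j ≤ J := Nat.lt_succ_iff.1 (Finset.mem_range.1 hj)
    have h1 : ((F j).card : ℝ) ≤ (2 ^ d) ^ (J - j) * (voidCount j (W j) ω : ℝ) := by
      rw [← hBcard]; exact_mod_cast card_filter_div_mem_le (B j)
    refine h1.trans ?_
    calc (2 ^ d : ℝ) ^ (J - j) * (voidCount j (W j) ω : ℝ)
        ≤ (2 ^ d) ^ (J - j) * (ε j * (2 ^ d : ℝ) ^ j) := by gcongr; exact (h j hj).le
      _ = ε j * (2 ^ d : ℝ) ^ J := by
        rw [← Nat.sub_add_cancel hjJ, pow_add, Nat.add_sub_cancel]; ring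
  have hGcard : (2 ^ d : ℝ) ^ J / 2 ≤ (G.card : ℝ) := by
    have h1 : (cells d J).card ≤ G.card + ∑ j ∈ Finset.range (J + 1), (F j).card := by
      have := Finset.card_le_card_sdiff_add_card (t := (Finset.range (J + 1)).biUnion F)
        (s := cells d J)
      exact this.trans (Nat.add_le_add_left Finset.card_biUnion_le _)
    rw [card_cells] at h1
    have h2 : (2 ^ d : ℝ) ^ J ≤ G.card + ∑ j ∈ Finset.range (J + 1), ((F j).card : ℝ) := by
      exact_mod_cast h1
    have h3 := Finset.sum_le_sum hFcard
    rw [← Finset.sum_mul] at h3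
    have h4 : (0 : ℝ) < (2 ^ d) ^ J := by positivity
    nlinarith
  have hGne : G.Nonempty := by
    rw [← Finset.card_pos]
    have : (0 : ℝ) < G.card := lt_of_lt_of_le (by positivity) hGcard
    exact_mod_cast this
  obtain ⟨K, hK⟩ := exists_card_le_ncard_supp hd hn hlam hW0 hWanti hW
    (J := J) (ω := ω) Finset.sdiff_subset hGne fun c hc j hj hvoid => by
      obtain ⟨hcJ, hcF⟩ := Finset.mem_sdiff.1 hc
      refine hcF (Finset.mem_biUnion.2 ⟨j, Finset.mem_range.2 (by omega), ?_⟩)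
      refine Finset.mem_filter.2 ⟨hcJ, Finset.mem_filter.2 ⟨mem_cells.2 fun i => ?_, hvoid⟩⟩
      rw [Nat.div_lt_iff_lt_mul (by positivity), ← pow_add, Nat.add_sub_cancel' hj]
      exact mem_cells.1 hcJ i
  exact ⟨K, hGcard.trans (by exact_mod_cast hK)⟩

/-! ### Measurability of the event -/

theorem measurableSet_linearComponentEvent (d : ℕ) (n : ℝ≥0) (lam c C : ℝ) :
    MeasurableSet (linearComponentEvent d n lam c C) := by
  -- A countable union over the number of vertices and the finitely many graphs on them.
  have hset : linearComponentEvent d n lam c C = ⋃ (N : ℕ) (G : SimpleGraph (Fin N))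
      (_ : ∃ K : G.ConnectedComponent,
        c * (n : ℝ) ≤ (K.supp.ncard : ℝ) ∧ (K.supp.ncard : ℝ) ≤ C * (n : ℝ)),
      {ω : Sample d | ω.1 = N ∧ ∀ u v : Fin N, G.Adj u v ↔ (u ≠ v ∧
        dist (ω.2 u).1 (ω.2 v).1 ≤
          (lam * (ω.2 u).2 * (ω.2 v).2 / (n : ℝ)) ^ (1 / (d : ℝ)))} := by
    ext ω
    simp only [Set.mem_iUnion, Set.mem_ofPred_eq, exists_prop]
    constructor
    · intro h
      exact ⟨ω.1, thresholdGraph n lam ω, h, rfl, fun u v => Iff.rfl⟩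
    · rintro ⟨N, G, hG, rfl, h⟩
      have : G = thresholdGraph n lam ω := by
        ext u v; exact h u v
      subst this
      exact hG
  rw [hset]
  refine MeasurableSet.iUnion fun N => MeasurableSet.iUnion fun G => MeasurableSet.iUnion fun _ => ?_
  refine measurableSet_setOfPred.2 (.and
    (measurableSet_setOfPred.1 (measurable_fst (measurableSet_singleton N)))
    (.forall fun u => .forall fun v => .iff measurable_const (.and measurable_const
      (measurableSet_setOfPred.1 (measurableSet_le ?_ ?_)))))
  · fun_prop
  · fun_prop

end

/-! ### Summing over the levels -/

theorem sum_range_pow_le_inv_one_sub {x : ℝ} (hx0 : 0 ≤ x) (hx1 : x < 1) (m : ℕ) :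
    ∑ j ∈ Finset.range m, x ^ j ≤ (1 - x)⁻¹ := by
  rw [← tsum_geometric_of_lt_one hx0 hx1]
  exact (summable_geometric_of_lt_one hx0 hx1).sum_le_tsum _ fun _ _ => pow_nonneg hx0 _

/-- Bernoulli's inequality `Q ^ j ≥ 1 + j * (Q - 1)` makes the terms decay at least like `(1 / 2) ^
j`, so the level-0 term dominates. -/
theorem sum_range_exp_neg_mul_pow_le {Q y : ℝ} (hQ : 1 < Q) (hy : 0 < y)
    (h : Real.log 2 ≤ y * (Q - 1)) (m : ℕ) :
    ∑ j ∈ Finset.range m, Real.exp (-(y * Q ^ j)) ≤ 2 * Real.exp (-y) := by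
  have hterm : ∀ j ∈ Finset.range m, Real.exp (-(y * Q ^ j)) ≤ Real.exp (-y) * (1 / 2) ^ j := by
    intro j _
    have hb := one_add_mul_le_pow (show (-2 : ℝ) ≤ Q - 1 by linarith) j
    rw [add_sub_cancel] at hb
    have h2 : ((1 : ℝ) / 2) ^ j = Real.exp (j * -Real.log 2) := by
      rw [Real.exp_nat_mul, Real.exp_neg, Real.exp_log two_pos, one_div]
    rw [h2, ← Real.exp_add]
    refine Real.exp_le_exp.2 ?_
    have h3 := mul_le_mul_of_nonneg_left hb hy.le
    have h4 := mul_le_mul_of_nonneg_left h (Nat.cast_nonneg (α := ℝ) j)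
    linarith
  refine (Finset.sum_le_sum hterm).trans ?_
  rw [← Finset.mul_sum, mul_comm]
  exact mul_le_mul_of_nonneg_right (sum_geometric_two_le m) (Real.exp_pos _).le

theorem mul_sqrt_rpow_neg {D lam m τ : ℝ} (hD : 0 < D) (hlam : 0 < lam) (hm : 0 < m) :
    m * √(D * m / lam) ^ (-(τ - 1)) =
      (D / lam) ^ (-((τ - 1) / 2)) * m ^ ((3 - τ) / 2) := by
  rw [Real.sqrt_eq_rpow, ← Real.rpow_mul (by positivity),
    show 1 / 2 * -(τ - 1) = -((τ - 1) / 2) by ring, mul_div_right_comm,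
    Real.mul_rpow (by positivity) hm.le,
    show (3 - τ) / 2 = 1 + -((τ - 1) / 2) by ring, Real.rpow_add hm, Real.rpow_one]
  ring

/-! ### Choice of parameters -/

/-- The failure probability of a linear-sized component is bounded by a sum over the levels. -/
theorem exists_forall_sampleLaw_real_compl_le {d : ℕ} (hd : 1 ≤ d) {τ : ℝ} (hτ₂ : 2 < τ)
    (hτ₃ : τ < 3) {lam : ℝ} (hlam : 0 < lam) :
    ∃ c b Q A : ℝ, 0 < c ∧ 0 < b ∧ 1 < Q ∧ 0 < A ∧ ∀ n : ℝ≥0, A ≤ n → ∃ J : ℕ,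
      (sampleLaw d n τ).real (linearComponentEvent d n lam c 4)ᶜ ≤ Real.exp (-n) +
        ∑ j ∈ Finset.range J, Real.exp (-(b * (n : ℝ) ^ ((3 - τ) / 2) * Q ^ j)) := by
  set D : ℝ := 2 ^ d with hD
  have hD2 : 2 ≤ D := by
    calc (2 : ℝ) = 2 ^ 1 := (pow_one 2).symm
      _ ≤ 2 ^ d := pow_le_pow_right₀ one_le_two hd
  have hD0 : 0 < D := by linarith
  set ξ := (3 - τ) / 2 with hξ
  have hξ0 : 0 < ξ := by linarith
  set κ := (D / lam) ^ (-((τ - 1) / 2)) with hκ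
  have hκ0 : 0 < κ := by positivity
  set ρ := D ^ ξ with hρ
  have hρ1 : 1 < ρ := Real.one_lt_rpow (by linarith) hξ0
  have hρ0 : 0 < ρ := by linarith
  -- Chosen so that `D = ρ * Q ^ 2`: then `D ^ j * μ j` grows like `Q ^ (2 * j)`. One factor `Q ^ j`
  -- pays for the decay of `ε j`, the other makes the failure bounds summable.
  set Q := D ^ ((τ - 1) / 4) with hQ
  have hQ1 : 1 < Q := Real.one_lt_rpow (by linarith) (by linarith)
  have hQ0 : 0 < Q := by linarith
  have hDρQ : D = ρ * Q * Q := by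
    rw [hρ, hQ, ← Real.rpow_add hD0, ← Real.rpow_add hD0,
      show ξ + (τ - 1) / 4 + (τ - 1) / 4 = 1 by rw [hξ]; ring, Real.rpow_one]
  have hQi : Q⁻¹ < 1 := inv_lt_one_of_one_lt₀ hQ1
  have hρi : ρ⁻¹ < 1 := inv_lt_one_of_one_lt₀ hρ1
  set δ := (1 - Q⁻¹) / 4 with hδ
  have hδ0 : 0 < δ := by linarith
  -- `A` is the least allowed mean number of points per cell: `lam ≤ A` gives `W j ≥ 1`, where the
  -- Pareto tail is exact, and the last condition makes the sum of `4 / μ j` at most `1 / 4`.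
  obtain ⟨A, hA1, hAlam, hAκ⟩ : ∃ A : ℝ, 1 ≤ A ∧ lam ≤ A ∧ 16 * (1 - ρ⁻¹)⁻¹ ≤ κ * A ^ ξ :=
    ((Filter.eventually_ge_atTop 1).and ((Filter.eventually_ge_atTop lam).and
      (((tendsto_rpow_atTop hξ0).const_mul_atTop hκ0).eventually_ge_atTop _))).exists
  have hA0 : 0 < A := by linarith
  refine ⟨1 / (2 * (A * D)), κ * δ / 4, Q, A, by positivity, by positivity, hQ1, hA0,
    fun n hn => ?_⟩
  have hn0 : (0 : ℝ) < n := hA0.trans_le hn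
  -- The deepest level with `n / D ^ J ≥ A`. Maximality gives `D ^ J > n / (A * D)`, and half of
  -- these leaves explain the constant `1 / (2 * (A * D))`.
  obtain ⟨J, hJ1, hJ2⟩ := exists_nat_pow_near ((one_le_div hA0).2 hn) (show 1 < D by linarith)
  rw [le_div_iff₀ hA0] at hJ1
  rw [div_lt_iff₀ hA0] at hJ2
  refine ⟨J + 1, ?_⟩
  set m : ℕ → ℝ := fun j => n / D ^ j with hm
  have hm0 : ∀ j, 0 < m j := fun j => by positivity
  set W : ℕ → ℝ := fun j => √(D * m j / lam) with hW
  set μ : ℕ → ℝ := fun j => κ * (n : ℝ) ^ ξ / ρ ^ j with hμ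
  have hμ0 : ∀ j, 0 < μ j := fun j => by positivity
  have hmA : ∀ j ≤ J, A ≤ m j := fun j hj => by
    rw [hm, le_div_iff₀ (by positivity), mul_comm]
    exact (mul_le_mul_of_nonneg_right (pow_le_pow_right₀ (by linarith) hj) hA0.le).trans hJ1
  have hW1 : ∀ j ≤ J, 1 ≤ W j := fun j hj => by
    rw [hW, Real.one_le_sqrt, one_le_div hlam]
    nlinarith [hmA j hj]
  have hmμ : ∀ j, κ * m j ^ ξ = μ j := fun j => by
    simp only [hm, hμ]
    rw [Real.div_rpow hn0.le (by positivity), ← Real.rpow_pow_comm hD0.le, mul_div_assoc]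
  have hμW : ∀ j, μ j = n * ((D ^ j)⁻¹ * W j ^ (-(τ - 1))) := fun j => by
    rw [← hmμ, hκ, hξ, ← mul_sqrt_rpow_neg hD0 hlam (hm0 j), ← mul_assoc, ← div_eq_mul_inv]
  -- The term `4 / μ j` secures `4 ≤ μ j * ε j` for the Chernoff bound; the term with `δ` carries
  -- the failure exponent. Each sums to at most `1 / 4`.
  set ε : ℕ → ℝ := fun j => δ * Q⁻¹ ^ j + 4 / μ j with hε
  have hμε : ∀ j, μ j * ε j = 4 + μ j * δ * Q⁻¹ ^ j := fun j => by
    have := (hμ0 j).ne'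
    simp only [hε]; field_simp; ring
  have hDμ : ∀ j, D ^ j * μ j = κ * (n : ℝ) ^ ξ * Q ^ j * Q ^ j := fun j => by
    have hD' : D ^ j = ρ ^ j * Q ^ j * Q ^ j := by rw [← mul_pow, ← mul_pow, ← hDρQ]
    rw [hD']; simp only [hμ]; field_simp
  have hεsum : ∑ j ∈ Finset.range (J + 1), ε j ≤ 1 / 2 := by
    have h1 : ∑ j ∈ Finset.range (J + 1), δ * Q⁻¹ ^ j ≤ 1 / 4 := by
      rw [← Finset.mul_sum]
      refine (mul_le_mul_of_nonneg_left
        (sum_range_pow_le_inv_one_sub (by positivity) hQi _) hδ0.le).trans_eq ?_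
      have : 1 - Q⁻¹ ≠ 0 := by linarith
      rw [hδ, div_mul_eq_mul_div, mul_inv_cancel₀ this]
    have h2 : ∑ j ∈ Finset.range (J + 1), 4 / μ j ≤ 1 / 4 := by
      -- The sum is geometric when read upwards from the leaves, where `μ` is smallest; the form `J
      -- + 1 - 1 - j` suits `Finset.sum_range_reflect`.
      have hterm : ∀ j ∈ Finset.range (J + 1),
          4 / μ j ≤ (1 - ρ⁻¹) / 4 * ρ⁻¹ ^ (J + 1 - 1 - j) := by
        intro j hj
        have hjJ : j ≤ J := Nat.lt_succ_iff.1 (Finset.mem_range.1 hj)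
        have hμJ : 16 * (1 - ρ⁻¹)⁻¹ ≤ μ J := by
          rw [← hmμ]
          exact hAκ.trans (mul_le_mul_of_nonneg_left
            (Real.rpow_le_rpow hA0.le (hmA J le_rfl) hξ0.le) hκ0.le)
        have hμj : μ j = μ J * ρ ^ (J - j) := by
          have hρJ : ρ ^ J = ρ ^ (J - j) * ρ ^ j := by rw [← pow_add, Nat.sub_add_cancel hjJ]
          simp only [hμ]; rw [hρJ]; field_simp
        have hpos : 0 < 1 - ρ⁻¹ := by linarith
        have hlow : 16 * (1 - ρ⁻¹)⁻¹ * ρ ^ (J - j) ≤ μ j := by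
          rw [hμj]; exact mul_le_mul_of_nonneg_right hμJ (by positivity)
        refine (div_le_div_of_nonneg_left (by norm_num) (by positivity) hlow).trans_eq ?_
        rw [Nat.add_sub_cancel, inv_pow]
        field_simp
        norm_num
      refine (Finset.sum_le_sum hterm).trans ?_
      rw [Finset.sum_range_reflect (fun k => (1 - ρ⁻¹) / 4 * ρ⁻¹ ^ k), ← Finset.mul_sum]
      have hpos : 0 < 1 - ρ⁻¹ := by linarith
      refine (mul_le_mul_of_nonneg_left
        (sum_range_pow_le_inv_one_sub (by positivity) hρi _) (by positivity)).trans_eq ?_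
      rw [div_mul_eq_mul_div, mul_inv_cancel₀ hpos.ne']
    simp only [hε]
    rw [Finset.sum_add_distrib]; linarith
  have hWanti : Antitone W := fun i j hij => by
    refine Real.sqrt_le_sqrt ?_
    simp only [hm]
    gcongr
    linarith
  have hWn : ∀ j, (n : ℝ) ≤ lam * W (j + 1) ^ 2 * (2 ^ d) ^ j := fun j => by
    simp only [hW]
    rw [Real.sq_sqrt (by have := hm0 (j + 1); positivity), ← hD]
    simp only [hm]
    refine le_of_eq ?_
    rw [pow_succ]; field_simp
  have hsub : (linearComponentEvent d n lam (1 / (2 * (A * D))) 4)ᶜ ⊆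
      {ω : Sample d | 4 * (n : ℝ) < ω.1} ∪ ⋃ j ∈ Finset.range (J + 1),
        {ω : Sample d | ε j * (2 ^ d : ℝ) ^ j ≤ voidCount j (W j) ω} := by
    intro ω hω
    by_contra hcon
    simp only [Set.mem_union, Set.mem_iUnion, Set.mem_ofPred_eq, not_or, not_lt, not_exists,
      not_le] at hcon
    obtain ⟨K, hK⟩ := exists_le_ncard_supp_of_voidCount_lt hd (n := n) hn0 hlam
      (fun j => Real.sqrt_nonneg _) hWanti hWn hεsum hcon.2
    refine hω ⟨K, le_trans ?_ hK, le_trans ?_ hcon.1⟩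
    · rw [← hD, one_div, inv_mul_le_iff₀ (by positivity)]
      rw [pow_succ] at hJ2
      linarith
    · have := Set.ncard_le_ncard (Set.subset_univ K.supp)
      rw [Set.ncard_univ, Nat.card_fin] at this
      exact_mod_cast this
  have := isProbabilityMeasure_sampleLaw d n (show 1 < τ by linarith)
  refine (measureReal_mono hsub).trans ((measureReal_union_le _ _).trans (add_le_add
    (sampleLaw_real_lt_fst_le_exp d n (by linarith)) ?_))
  refine (measureReal_biUnion_finset_le _ _).trans (Finset.sum_le_sum fun j hj => ?_)
  have hjJ : j ≤ J := Nat.lt_succ_iff.1 (Finset.mem_range.1 hj)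
  refine (sampleLaw_real_le_voidCount n (by linarith) (hW1 j hjJ) (hμW j) ?_).trans
    (Real.exp_le_exp.2 (neg_le_neg ?_))
  · rw [hμε]
    have : 0 ≤ μ j * δ * Q⁻¹ ^ j := by have := hμ0 j; positivity
    linarith
  · rw [← hD]
    have e : D ^ j * μ j * ε j / 4 =
        κ * δ / 4 * (n : ℝ) ^ ξ * Q ^ j + D ^ j := by
      rw [mul_assoc, hμε, mul_add, ← mul_assoc, ← mul_assoc, hDμ, inv_pow]
      field_simp
      ring
    rw [e]
    have : 0 < D ^ j := by positivity
    linarith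

end GIRG

/-! ### Conclusion -/

theorem theorem1 (d : ℕ) (hd : 1 ≤ d) (τ : ℝ) (hτ₂ : 2 < τ) (hτ₃ : τ < 3)
    (lam : ℝ) (hlam : 0 < lam) :
    ∃ c C a : ℝ, 0 < c ∧ 0 < C ∧ 0 < a ∧ ∃ n₀ : ℝ≥0, ∀ n : ℝ≥0, n₀ ≤ n →
      MeasurableSet (GIRG.linearComponentEvent d n lam c C) ∧
      1 - Real.exp (-(a * (n : ℝ) ^ ((3 - τ) / 2))) ≤
        (GIRG.sampleLaw d n τ).real (GIRG.linearComponentEvent d n lam c C) := by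
  obtain ⟨c, b, Q, A, hc, hb, hQ, hA, h⟩ :=
    GIRG.exists_forall_sampleLaw_real_compl_le hd hτ₂ hτ₃ hlam
  set ξ := (3 - τ) / 2 with hξ
  have hξ0 : 0 < ξ := by linarith
  set a := min b 1 with ha
  have ha0 : 0 < a := lt_min hb one_pos
  obtain ⟨x₀, hx₀⟩ := Filter.eventually_atTop.1
    ((((tendsto_rpow_atTop hξ0).const_mul_atTop ha0).eventually_ge_atTop (2 * Real.log 3)).and
      (((tendsto_rpow_atTop hξ0).const_mul_atTop hb).eventually_ge_atTop (Real.log 2 / (Q - 1))))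
  refine ⟨c, 4, a / 2, hc, by norm_num, by positivity,
    (max x₀ (max A 1)).toNNReal, fun n hn => ?_⟩
  have hn' : max x₀ (max A 1) ≤ n := Real.toNNReal_le_iff_le_coe.1 hn
  obtain ⟨hnx, hnA⟩ := max_le_iff.1 hn'
  obtain ⟨hnA, hn1⟩ := max_le_iff.1 hnA
  obtain ⟨h1, h2⟩ := hx₀ n hnx
  have hmeas := GIRG.measurableSet_linearComponentEvent d n lam c 4
  refine ⟨hmeas, ?_⟩
  obtain ⟨J, hJ⟩ := h n hnA
  have := GIRG.isProbabilityMeasure_sampleLaw d n (show 1 < τ by linarith)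
  rw [probReal_compl_eq_one_sub hmeas] at hJ
  set y := (n : ℝ) ^ ξ with hy
  have hy0 : 0 < y := by positivity
  have hyn : y ≤ n := by
    calc y ≤ (n : ℝ) ^ (1 : ℝ) := Real.rpow_le_rpow_of_exponent_le hn1 (by linarith)
      _ = n := Real.rpow_one _
  have hsum := GIRG.sum_range_exp_neg_mul_pow_le hQ (mul_pos hb hy0)
    ((div_le_iff₀ (by linarith)).1 h2) J
  have e1 : Real.exp (-(b * y)) ≤ Real.exp (-(a * y)) :=
    Real.exp_le_exp.2 (neg_le_neg (mul_le_mul_of_nonneg_right (min_le_left _ _) hy0.le))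
  have e2 : Real.exp (-(n : ℝ)) ≤ Real.exp (-(a * y)) := by
    refine Real.exp_le_exp.2 (neg_le_neg ?_)
    calc a * y ≤ 1 * y := mul_le_mul_of_nonneg_right (min_le_right _ _) hy0.le
      _ ≤ n := by rw [one_mul]; exact hyn
  -- The Poisson tail and the level sum give `1 + 2` terms of size `exp (-(a * y))`; halving `a`
  -- absorbs the factor 3, as `a * y ≥ 2 * log 3`.
  have e3 : 3 * Real.exp (-(a * y)) ≤ Real.exp (-(a / 2 * y)) := by
    rw [← Real.exp_log (show (0 : ℝ) < 3 by norm_num), ← Real.exp_add]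
    refine Real.exp_le_exp.2 ?_
    linarith
  linarith
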